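/- Let $r\ge 2$ and $n\ge 4(r-1)^2$ be integers, and let $G$ be an $r$-partite graph of order $n$, i.e. a simple graph whose $n$ vertices can be partitioned into (at most) $r$ edgeless sets. Let $\|G\|_*$ denote the trace norm of $G$, that is, the sum of the singular values of its adjacency matrix, and let $\lambda_1(G)\ge\dots\ge\lambda_n(G)$ be the eigenvalues of the adjacency matrix, counted with multiplicity. Then $$\|G\|_*\le \frac{n(n-r)}{2\sqrt{(n-r)\frac{r}{r-1}+4}}+\frac{(r-1)n}{r}+\frac{2(r-1)n}{r\sqrt{(n-r)\frac{r}{r-1}+4}}.$$ Equality holds if and only if the following three conditions are met: (i) $G$ is a regular graph of degree $$\Bigl(1+\frac{2}{\sqrt{(n-r)\frac{r}{r-1}+4}}\Bigr)\frac{(r-1)n}{2r};$$ (ii) the $r-1$ smallest eigenvalues of $G$ satisfy $$\lambda_n(G)=\cdots=\lambda_{n-r+2}(G)=-\Bigl(1+\frac{2}{\sqrt{(n-r)\frac{r}{r-1}+4}}\Bigr)\frac{n}{2r};$$ (iii) the eigenvalues $\lambda_2(G),\dots,\lambda_{n-r+1}(G)$ satisfy $$|\lambda_2(G)|=\cdots=|\lambda_{n-r+1}(G)|=\frac{n}{2\sqrt{(n-r)\frac{r}{r-1}+4}}.$$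 -/

import Mathlib

/-- The trace norm (nuclear norm) of a matrix: the sum of its singular values. -/
noncomputable def Matrix.traceNorm {𝕜 : Type*} [RCLike 𝕜] {m n : Type*} [Fintype m] [Fintype n]
    [DecidableEq n] (A : Matrix m n 𝕜) : ℝ :=
  ∑ i ∈ Finset.range (Fintype.card n), (Matrix.toEuclideanLin A).singularValues i

/-- The trace norm of a graph: the trace norm of its adjacency matrix. -/
noncomputable def SimpleGraph.traceNorm {V : Type*} [Fintype V] [DecidableEq V]
    (G : SimpleGraph V) [DecidableRel G.Adj] : ℝ :=
  (G.adjMatrix ℝ).traceNorm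

theorem SimpleGraph.isHermitian_adjMatrix_real {V : Type*} (G : SimpleGraph V)
    [DecidableRel G.Adj] : (G.adjMatrix ℝ).IsHermitian := by
  rw [Matrix.IsHermitian, Matrix.conjTranspose_eq_transpose_of_trivial]
  exact G.isSymm_adjMatrix

/-- The eigenvalues of the adjacency matrix of a graph on `n` vertices, with multiplicity and in
descending order. Indices start at `0`: `G.eigenvalue i` is the `(i + 1)`-th largest one. -/
noncomputable def SimpleGraph.eigenvalue {V : Type*} [Fintype V] [DecidableEq V]
    (G : SimpleGraph V) [DecidableRel G.Adj] (i : Fin (Fintype.card V)) : ℝ :=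
  G.isHermitian_adjMatrix_real.eigenvalues₀ i

/-! ### Spectra of real symmetric operators. -/

namespace LinearMap.IsSymmetric

variable {E : Type*} [NormedAddCommGroup E] [InnerProductSpace ℝ E] [FiniteDimensional ℝ E]
  {T : E →ₗ[ℝ] E} {n : ℕ}

/-! The trace norm is the sum of the `|λ_i|`. Two constraints bound it: `∑ λ_i² = 2m ≤ n λ_1`, from
the Rayleigh quotient at the all-ones vector, and a Hoffman-type bound of `λ_1` by the negative
parts of the last `r - 1` eigenvalues (`exists_weights`, `le_sum_last_of_weights`). Let `t` and `μ`
be the extremal absolute values of the middle and last eigenvalues. In `sum_abs_le_and_eq_iff`, `2t`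
times the gap to the bound is the slack of the first constraint, plus `2(μ - t)` times a Hoffman
slack, plus the squares `(λ_1 - (r-1)μ)²`, `(|λ_i| - t)²` and `(|λ_i| - μ)²`. The size of `n` gives
`t ≤ μ`, so all terms are nonnegative; equality makes the squares and the first slack vanish, and
the latter forces regularity. -/

theorem map_eigenvalues_adjoint_comp_self (hT : T.IsSymmetric) (hn : Module.finrank ℝ E = n) :
    Multiset.map (T.isSymmetric_adjoint_comp_self.eigenvalues hn) Finset.univ.val =
      Multiset.map (fun i ↦ hT.eigenvalues hn i ^ 2) Finset.univ.val := by
  have h1 := T.isSymmetric_adjoint_comp_self.roots_charpoly_eq_eigenvalues hn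
  -- An eigenbasis of `T` diagonalizes `T* T`. Squaring does not preserve the order of eigenvalues,
  -- so the comparison goes through roots of the characteristic polynomial, as multisets.
  have h2 : (LinearMap.adjoint T ∘ₗ T).toMatrix (hT.eigenvectorBasis hn).toBasis
      (hT.eigenvectorBasis hn).toBasis =
        Matrix.diagonal (fun i ↦ hT.eigenvalues hn i ^ 2) := by
    have hadj : LinearMap.adjoint T = T :=
      LinearMap.isSelfAdjoint_iff'.1 ((LinearMap.isSymmetric_iff_isSelfAdjoint T).1 hT)
    rw [hadj]
    ext i j
    have hTT : T (T (hT.eigenvectorBasis hn j)) =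
        (hT.eigenvalues hn j ^ 2) • hT.eigenvectorBasis hn j := by
      simp [smul_smul, sq]
    rw [LinearMap.toMatrix_apply, LinearMap.comp_apply, OrthonormalBasis.coe_toBasis, hTT]
    simp only [map_smul, OrthonormalBasis.coe_toBasis_repr_apply, OrthonormalBasis.repr_self,
      Finsupp.smul_apply, PiLp.single_apply, Matrix.diagonal_apply,
      smul_eq_mul]
    split_ifs with h
    · simp [h]
    · simp
  rw [← LinearMap.charpoly_toMatrix _ (hT.eigenvectorBasis hn).toBasis, h2,
    Matrix.charpoly_diagonal, Polynomial.roots_prod _ _ (by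
      simp only [Finset.prod_ne_zero_iff]
      exact fun i _ ↦ Polynomial.X_sub_C_ne_zero _)] at h1
  simp only [Polynomial.roots_X_sub_C, Multiset.bind_singleton] at h1
  exact h1.symm

theorem sum_singularValues_eq_sum_abs_eigenvalues (hT : T.IsSymmetric)
    (hn : Module.finrank ℝ E = n) :
    ∑ i ∈ Finset.range n, T.singularValues i = ∑ i, |hT.eigenvalues hn i| := by
  have h := congrArg (fun s ↦ (s.map Real.sqrt).sum) (hT.map_eigenvalues_adjoint_comp_self hn)
  simp only [Multiset.map_map, Function.comp_def, Real.sqrt_sq_eq_abs] at h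
  rw [Finset.sum_range]
  simp only [T.singularValues_fin hn]
  exact h

theorem inner_apply_self_eq_sum (hT : T.IsSymmetric) (hn : Module.finrank ℝ E = n) (x : E) :
    inner ℝ x (T x) =
      ∑ i, hT.eigenvalues hn i * (inner ℝ x (hT.eigenvectorBasis hn i)) ^ 2 := by
  rw [← (hT.eigenvectorBasis hn).sum_inner_mul_inner x (T x)]
  refine Finset.sum_congr rfl fun i _ ↦ ?_
  rw [← hT, hT.apply_eigenvectorBasis, inner_smul_left, real_inner_comm]
  simp
  ring

theorem trace_comp_self_eq_sum (hT : T.IsSymmetric) (hn : Module.finrank ℝ E = n) :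
    LinearMap.trace ℝ E (T ∘ₗ T) = ∑ i, hT.eigenvalues hn i ^ 2 := by
  rw [LinearMap.trace_eq_sum_inner _ (hT.eigenvectorBasis hn)]
  refine Finset.sum_congr rfl fun i _ ↦ ?_
  simp [hT.apply_eigenvectorBasis, inner_smul_right, sq]

/-- A vector attaining the largest value of the Rayleigh quotient is an eigenvector. -/
theorem apply_eq_smul_of_inner_eq (hT : T.IsSymmetric) (hn : Module.finrank ℝ E = n) {M : ℝ}
    (hM : ∀ i, hT.eigenvalues hn i ≤ M) {x : E} (hx : inner ℝ x (T x) = M * ‖x‖ ^ 2) :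
    T x = M • x := by
  have h0 : ∑ i, (M - hT.eigenvalues hn i) * (inner ℝ x (hT.eigenvectorBasis hn i)) ^ 2 = 0 := by
    simp only [sub_mul, Finset.sum_sub_distrib, ← Finset.mul_sum,
      (hT.eigenvectorBasis hn).sum_sq_inner_left, ← hT.inner_apply_self_eq_sum hn, hx, sub_self]
  rw [Finset.sum_eq_zero_iff_of_nonneg fun i _ ↦
    mul_nonneg (sub_nonneg.2 (hM i)) (sq_nonneg _)] at h0
  refine (hT.eigenvectorBasis hn).repr.injective ?_
  ext i
  have := h0 i (Finset.mem_univ i)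
  rw [eigenvectorBasis_apply_self_apply]
  simp only [map_smul, PiLp.smul_apply, smul_eq_mul, OrthonormalBasis.repr_apply_apply,
    real_inner_comm x] at this ⊢
  rcases mul_eq_zero.1 this with h | h
  · rw [sub_eq_zero.1 h]; simp
  · simp [pow_eq_zero_iff] at h; simp [h]

theorem inner_apply_self_le (hT : T.IsSymmetric) (hn : Module.finrank ℝ E = n) {M : ℝ}
    (hM : ∀ i, hT.eigenvalues hn i ≤ M) (x : E) : inner ℝ x (T x) ≤ M * ‖x‖ ^ 2 := by
  rw [hT.inner_apply_self_eq_sum hn, ← (hT.eigenvectorBasis hn).sum_sq_inner_left, Finset.mul_sum]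
  gcongr with i
  exact hM i

end LinearMap.IsSymmetric

/-! ### Restriction to color classes. -/

/-- The restriction of a vector to one color class. -/
noncomputable def colorRestrict {V κ : Type*} [DecidableEq κ] (c : V → κ) (k : κ)
    (x : EuclideanSpace ℝ V) : EuclideanSpace ℝ V :=
  WithLp.toLp 2 fun v ↦ if c v = k then x v else 0

section colorRestrict

variable {V κ : Type*} [Fintype V] [DecidableEq κ] (c : V → κ)

theorem inner_colorRestrict_left (k : κ) (x y : EuclideanSpace ℝ V) :
    inner ℝ (colorRestrict c k x) y = inner ℝ (colorRestrict c k x) (colorRestrict c k y) := by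
  simp only [PiLp.inner_apply, colorRestrict]
  refine Finset.sum_congr rfl fun v _ ↦ ?_
  split_ifs <;> simp

theorem sum_norm_sq_colorRestrict [Fintype κ] (x : EuclideanSpace ℝ V) :
    ∑ k, ‖colorRestrict c k x‖ ^ 2 = ‖x‖ ^ 2 := by
  simp only [EuclideanSpace.norm_sq_eq, colorRestrict]
  rw [Finset.sum_comm]
  refine Finset.sum_congr rfl fun v _ ↦ ?_
  rw [Finset.sum_eq_single (c v)] <;> simp +contextual [eq_comm]

/-- The restriction of a vector to one color class, scaled to norm one unless it vanishes. -/
noncomputable def unitColorRestrict (k : κ) (x : EuclideanSpace ℝ V) : EuclideanSpace ℝ V :=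
  ‖colorRestrict c k x‖⁻¹ • colorRestrict c k x

theorem norm_unitColorRestrict_le_one (k : κ) (x : EuclideanSpace ℝ V) :
    ‖unitColorRestrict c k x‖ ≤ 1 := by
  rw [unitColorRestrict, norm_smul, norm_inv, norm_norm]
  exact inv_mul_le_one

theorem inner_unitColorRestrict_self (k : κ) (x : EuclideanSpace ℝ V) :
    inner ℝ (unitColorRestrict c k x) x = ‖colorRestrict c k x‖ := by
  rw [unitColorRestrict, real_inner_smul_left, inner_colorRestrict_left,
    real_inner_self_eq_norm_sq, sq, ← mul_assoc]
  -- For a vanishing restriction the inverse of the norm is `0`, so both sides are `0`.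
  rcases eq_or_ne ‖colorRestrict c k x‖ 0 with h | h
  · simp [h]
  · rw [inv_mul_cancel₀ h, one_mul]

theorem inner_unitColorRestrict_sq_le (k : κ) (x y : EuclideanSpace ℝ V) :
    (inner ℝ (unitColorRestrict c k x) y) ^ 2 ≤ ‖colorRestrict c k y‖ ^ 2 := by
  have h : inner ℝ (unitColorRestrict c k x) y =
      inner ℝ (unitColorRestrict c k x) (colorRestrict c k y) := by
    simp only [unitColorRestrict, real_inner_smul_left]
    rw [inner_colorRestrict_left]
  rw [h]
  refine sq_le_sq' ?_ ?_ <;> have := abs_le.1 ((abs_real_inner_le_norm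
      (unitColorRestrict c k x) (colorRestrict c k y)).trans (mul_le_of_le_one_left
        (norm_nonneg _) (norm_unitColorRestrict_le_one c k x)))
  exacts [this.1, this.2]

end colorRestrict

/-! ### Adjacency spectrum, degrees and colorings. -/

namespace SimpleGraph

variable {V : Type*} [Fintype V] [DecidableEq V] (G : SimpleGraph V) [DecidableRel G.Adj]

theorem isSymmetric_toEuclideanLin_adjMatrix :
    (Matrix.toEuclideanLin (G.adjMatrix ℝ)).IsSymmetric :=
  Matrix.isSymmetric_toEuclideanLin_iff.2 G.isHermitian_adjMatrix_real

theorem eigenvalue_antitone : Antitone G.eigenvalue :=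
  G.isHermitian_adjMatrix_real.eigenvalues₀_antitone

theorem eigenvalue_eq : G.eigenvalue =
    G.isSymmetric_toEuclideanLin_adjMatrix.eigenvalues finrank_euclideanSpace := rfl

theorem traceNorm_eq_sum_abs_eigenvalue : G.traceNorm = ∑ i, |G.eigenvalue i| :=
  G.isSymmetric_toEuclideanLin_adjMatrix.sum_singularValues_eq_sum_abs_eigenvalues
    finrank_euclideanSpace

theorem sum_eigenvalue_sq : ∑ i, G.eigenvalue i ^ 2 = ∑ v, (G.degree v : ℝ) := by
  rw [eigenvalue_eq, ← LinearMap.IsSymmetric.trace_comp_self_eq_sum,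
    LinearMap.trace_eq_sum_inner _ (EuclideanSpace.basisFun V ℝ)]
  refine Finset.sum_congr rfl fun v _ ↦ ?_
  rw [LinearMap.comp_apply, ← G.isSymmetric_toEuclideanLin_adjMatrix]
  simp [EuclideanSpace.norm_sq_eq, Matrix.toLpLin_apply, G.adj_comm _ v,
    ← card_neighborFinset_eq_degree, neighborFinset_eq_filter]

theorem toEuclideanLin_adjMatrix_one (v : V) :
    Matrix.toEuclideanLin (G.adjMatrix ℝ) (WithLp.toLp 2 fun _ ↦ 1) v = G.degree v := by
  simp [Matrix.toLpLin_apply]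

theorem norm_toLp_one_sq (V : Type*) [Fintype V] :
    ‖(WithLp.toLp 2 fun _ ↦ 1 : EuclideanSpace ℝ V)‖ ^ 2 = Fintype.card V := by
  simp [EuclideanSpace.norm_sq_eq]

theorem inner_one_adjMatrix_one :
    inner ℝ (WithLp.toLp 2 fun _ ↦ 1 : EuclideanSpace ℝ V)
      (Matrix.toEuclideanLin (G.adjMatrix ℝ) (WithLp.toLp 2 fun _ ↦ 1)) =
        ∑ v, (G.degree v : ℝ) := by
  simp [PiLp.inner_apply]

theorem sum_degree_le {M : ℝ} (hM : ∀ i, G.eigenvalue i ≤ M) :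
    ∑ v, (G.degree v : ℝ) ≤ M * Fintype.card V := by
  rw [← inner_one_adjMatrix_one, ← norm_toLp_one_sq]
  exact G.isSymmetric_toEuclideanLin_adjMatrix.inner_apply_self_le finrank_euclideanSpace hM _

theorem degree_eq_of_sum_degree_eq {M : ℝ} (hM : ∀ i, G.eigenvalue i ≤ M)
    (h : ∑ v, (G.degree v : ℝ) = M * Fintype.card V) (v : V) : (G.degree v : ℝ) = M := by
  rw [← inner_one_adjMatrix_one, ← norm_toLp_one_sq] at h
  have := G.isSymmetric_toEuclideanLin_adjMatrix.apply_eq_smul_of_inner_eq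
    finrank_euclideanSpace hM h
  rw [← toEuclideanLin_adjMatrix_one, this]
  simp

theorem inner_colorRestrict_adjMatrix {κ : Type*} [DecidableEq κ] (C : G.Coloring κ)
    (k : κ) (x : EuclideanSpace ℝ V) :
    inner ℝ (colorRestrict C k x)
      (Matrix.toEuclideanLin (G.adjMatrix ℝ) (colorRestrict C k x)) = 0 := by
  simp only [PiLp.inner_apply, Matrix.toLpLin_apply, colorRestrict, adjMatrix_mulVec_apply]
  refine Finset.sum_eq_zero fun v _ ↦ ?_
  by_cases hv : C v = k
  · rw [Finset.sum_eq_zero]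
    · simp
    · intro w hw
      rw [mem_neighborFinset] at hw
      rw [if_neg]
      rintro hw'
      exact C.valid hw (hv.trans hw'.symm)
  · simp [hv]

/-- The weights `q` are the diagonal entries, in an eigenbasis, of the projection onto the span of
the parts of a leading eigenvector. -/
theorem exists_weights {r : ℕ} (hG : G.Colorable r) (j : Fin (Fintype.card V)) :
    ∃ q : Fin (Fintype.card V) → ℝ, (∀ i, 0 ≤ q i) ∧ (∀ i, q i ≤ 1) ∧ q j = 1 ∧
      ∑ i, q i ≤ r ∧ ∑ i, G.eigenvalue i * q i = 0 := by
  obtain ⟨C⟩ := hG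
  set hT := G.isSymmetric_toEuclideanLin_adjMatrix
  set b := hT.eigenvectorBasis (finrank_euclideanSpace (𝕜 := ℝ) (ι := V)) with hb
  set e : Fin r → EuclideanSpace ℝ V := fun k ↦ unitColorRestrict C k (b j) with he
  have hb1 : ∀ i, ‖b i‖ ^ 2 = 1 := fun i ↦ by rw [b.orthonormal.1 i, one_pow]
  refine ⟨fun i ↦ ∑ k, (inner ℝ (e k) (b i)) ^ 2, fun i ↦ ?_, fun i ↦ ?_, ?_, ?_, ?_⟩
  · positivity
  -- Bessel's inequality, class by class.
  · rw [← hb1 i, ← sum_norm_sq_colorRestrict C (b i)]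
    exact Finset.sum_le_sum fun k _ ↦ inner_unitColorRestrict_sq_le C k _ _
  · simp only [he, inner_unitColorRestrict_self, sum_norm_sq_colorRestrict, hb1]
  · rw [Finset.sum_comm]
    simp only [b.sum_sq_inner_left]
    refine (Finset.sum_le_card_nsmul _ _ 1 fun k _ ↦ ?_).trans (by simp)
    exact pow_le_one₀ (norm_nonneg _) (norm_unitColorRestrict_le_one C k _)
  · simp only [Finset.mul_sum]
    rw [Finset.sum_comm]
    refine Finset.sum_eq_zero fun k _ ↦ ?_
    rw [eigenvalue_eq, hb, ← hT.inner_apply_self_eq_sum]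
    -- Each `e k` is supported on an edgeless class, so the quadratic form vanishes on it.
    simp only [he, unitColorRestrict, map_smul, inner_smul_left, inner_smul_right,
      inner_colorRestrict_adjMatrix, mul_zero]

end SimpleGraph

/-! ### Inequalities for ordered real sequences. -/

section Fin

variable {N r : ℕ}

/-- All indices but the first and the last `r - 1` ones. -/
def midIndices (N r : ℕ) : Finset (Fin N) := {i | 1 ≤ (i : ℕ) ∧ (i : ℕ) + r ≤ N}

/-- The last `r - 1` indices. -/
def lastIndices (N r : ℕ) : Finset (Fin N) := {i | N + 1 ≤ (i : ℕ) + r}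

@[simp]
theorem mem_midIndices {i : Fin N} : i ∈ midIndices N r ↔ 1 ≤ (i : ℕ) ∧ (i : ℕ) + r ≤ N := by
  simp [midIndices]

@[simp]
theorem mem_lastIndices {i : Fin N} : i ∈ lastIndices N r ↔ N + 1 ≤ (i : ℕ) + r := by
  simp [lastIndices]

theorem Fin.sum_eq_add_sum_mid_add_sum_last [NeZero N] (hrN : r ≤ N)
    (f : Fin N → ℝ) :
    ∑ i, f i = f 0 + ∑ i ∈ midIndices N r, f i +
      ∑ i ∈ lastIndices N r, f i := by
  have h0 : Finset.univ = insert 0 (midIndices N r ∪ lastIndices N r) := by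
    ext i
    simp only [Finset.mem_univ, Finset.mem_insert, Finset.mem_union, mem_midIndices,
      mem_lastIndices, Fin.ext_iff, Fin.coe_ofNat_eq_mod, Nat.zero_mod, true_iff]
    have := i.isLt
    omega
  rw [h0, Finset.sum_insert, Finset.sum_union, add_assoc]
  · rw [Finset.disjoint_left]
    simp
  · simp only [Finset.mem_union, mem_midIndices, mem_lastIndices, Fin.coe_ofNat_eq_mod,
      Nat.zero_mod]
    omega

theorem card_lastIndices (hr : 2 ≤ r) (hrN : r ≤ N) :
    (lastIndices N r).card = r - 1 := by
  have h : (lastIndices N r) =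
      Finset.Ici ⟨N + 1 - r, by omega⟩ := by
    ext i; simp [Fin.le_def]
  rw [h, Fin.card_Ici]
  dsimp; omega

theorem card_midIndices (hr : 2 ≤ r) (hrN : r ≤ N) :
    (midIndices N r).card = N - r := by
  have : NeZero N := ⟨by omega⟩
  have h := Fin.sum_eq_add_sum_mid_add_sum_last hrN (fun _ ↦ (1 : ℝ))
  simp only [Finset.sum_const, card_lastIndices hr hrN, nsmul_eq_mul, mul_one,
    Finset.card_univ, Fintype.card_fin] at h
  norm_cast at h
  omega

/-- A fractional knapsack: with one unit of weight fixed at index `0`, the remaining `r - 1` units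
are best spent on the largest values, which sit at the end. -/
theorem sum_mul_weights_le [NeZero N] (hr : 2 ≤ r) (hrN : r ≤ N) {p q : Fin N → ℝ}
    (hp : Monotone p) (hp0 : ∀ i, 0 ≤ p i) (hq0 : ∀ i, 0 ≤ q i) (hq1 : ∀ i, q i ≤ 1)
    (hq : q 0 = 1) (hqr : ∑ i, q i ≤ r) :
    ∑ i, p i * q i ≤ p 0 + ∑ i ∈ lastIndices N r, p i := by
  -- The threshold is the smallest value among the last `r - 1`; moving weight across it costs
  -- nothing.
  set c := p ⟨N + 1 - r, by omega⟩ with hc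
  have h1 : ∑ i ∈ midIndices N r, p i * q i ≤
      ∑ i ∈ midIndices N r, c * q i := by
    refine Finset.sum_le_sum fun i hi ↦ mul_le_mul_of_nonneg_right (hp ?_) (hq0 i)
    simp only [mem_midIndices] at hi
    rw [Fin.le_def]; dsimp; omega
  have h2 : ∑ i ∈ lastIndices N r, p i * q i ≤
      ∑ i ∈ lastIndices N r, (p i - c + c * q i) := by
    refine Finset.sum_le_sum fun i hi ↦ ?_
    have : c ≤ p i := by
      refine hp ?_
      simp only [mem_lastIndices] at hi
      rw [Fin.le_def]; dsimp; omega
    nlinarith [mul_nonneg (sub_nonneg.2 this) (sub_nonneg.2 (hq1 i))]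
  rw [Fin.sum_eq_add_sum_mid_add_sum_last hrN, hq] at hqr ⊢
  rw [← Finset.mul_sum] at h1
  rw [Finset.sum_add_distrib, Finset.sum_sub_distrib, Finset.sum_const,
    card_lastIndices hr hrN, nsmul_eq_mul, ← Finset.mul_sum,
    Nat.cast_sub (by omega)] at h2
  have hc0 : 0 ≤ c := hp0 _
  push_cast at h2
  nlinarith [mul_nonneg hc0 (sub_nonneg.2 hqr)]

/-- The Hoffman inequality, for a sequence that admits the weights of `SimpleGraph.exists_weights`. -/
theorem le_sum_last_of_weights [NeZero N] (hr : 2 ≤ r) (hrN : r ≤ N) {l q : Fin N → ℝ}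
    (hl : Antitone l) (hl0 : 0 ≤ l 0) (hq0 : ∀ i, 0 ≤ q i) (hq1 : ∀ i, q i ≤ 1)
    (hq : q 0 = 1) (hqr : ∑ i, q i ≤ r) (hlq : ∑ i, l i * q i = 0) :
    l 0 ≤ ∑ i ∈ lastIndices N r, max (-l i) 0 := by
  have h := sum_mul_weights_le hr hrN (p := fun i ↦ max (-l i) 0)
    (fun i j hij ↦ max_le_max_right _ (neg_le_neg (hl hij))) (fun i ↦ le_max_right _ _)
    hq0 hq1 hq hqr
  -- Every term is nonnegative, and the one at index `0` equals `l 0`.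
  have h2 : l 0 ≤ ∑ i, (max (-l i) 0 * q i + l i * q i) := by
    refine le_trans ?_ (Finset.single_le_sum (fun i _ ↦ ?_) (Finset.mem_univ (0 : Fin N)))
    · simp [hq]
    · rw [← add_mul]
      exact mul_nonneg (by linarith [le_max_left (-l i) 0]) (hq0 i)
  rw [Finset.sum_add_distrib, hlq, add_zero] at h2
  simp only [max_eq_right (neg_nonpos.2 hl0), zero_add] at h
  exact h2.trans h

/-- The trace norm estimate in terms of the eigenvalue sequence: `t` and `μ` are the extremal
absolute values of the middle and of the last eigenvalues. -/
theorem sum_abs_le_and_eq_iff [NeZero N] (hr : 2 ≤ r) (hrN : r ≤ N) {l : Fin N → ℝ} {t μ : ℝ}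
    (ht : 0 < t) (hμ : t ≤ μ) (hμr : r * μ = N / 2 + 2 * t)
    (hid : N * ((r - 1) * μ) = ((r - 1) * μ) ^ 2 + (r - 1) * μ ^ 2 + (N - r) * t ^ 2)
    (hl0 : 0 ≤ l 0) (hsq : ∑ i, l i ^ 2 ≤ N * l 0)
    (hlast : l 0 ≤ ∑ i ∈ lastIndices N r, max (-l i) 0) :
    ∑ i, |l i| ≤ 2 * ((r - 1) * μ) + (N - r) * t ∧
    (∑ i, |l i| = 2 * ((r - 1) * μ) + (N - r) * t ↔
      ∑ i, l i ^ 2 = N * l 0 ∧ l 0 = (r - 1) * μ ∧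
        (∀ i : Fin N, N + 1 ≤ (i : ℕ) + r → l i = -μ) ∧
        (∀ i : Fin N, 1 ≤ (i : ℕ) → (i : ℕ) + r ≤ N → |l i| = t)) := by
  have hlast' : ∑ i ∈ lastIndices N r, max (-l i) 0 ≤
      ∑ i ∈ lastIndices N r, |l i| :=
    Finset.sum_le_sum fun i _ ↦ max_le (neg_le_abs _) (abs_nonneg _)
  have hcl : ((lastIndices N r).card : ℝ) = r - 1 := by
    rw [card_lastIndices hr hrN, Nat.cast_sub (by omega), Nat.cast_one]
  have hcm : ((midIndices N r).card : ℝ) =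
      N - r := by
    rw [card_midIndices hr hrN, Nat.cast_sub hrN]
  have hM : ∑ i ∈ midIndices N r, (|l i| - t) ^ 2 =
      ∑ i ∈ midIndices N r, l i ^ 2 -
        2 * t * ∑ i ∈ midIndices N r, |l i| + (N - r) * t ^ 2 := by
    rw [← hcm, ← nsmul_eq_mul, ← Finset.sum_const, Finset.mul_sum, ← Finset.sum_sub_distrib,
      ← Finset.sum_add_distrib]
    refine Finset.sum_congr rfl fun i _ ↦ ?_
    rw [← sq_abs (l i)]; ring
  have hL : ∑ i ∈ lastIndices N r, (|l i| - μ) ^ 2 =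
      ∑ i ∈ lastIndices N r, l i ^ 2 -
        2 * μ * ∑ i ∈ lastIndices N r, |l i| + (r - 1) * μ ^ 2 := by
    rw [← hcl, ← nsmul_eq_mul, ← Finset.sum_const, Finset.mul_sum, ← Finset.sum_sub_distrib,
      ← Finset.sum_add_distrib]
    refine Finset.sum_congr rfl fun i _ ↦ ?_
    rw [← sq_abs (l i)]; ring
  have hM0 : 0 ≤ ∑ i ∈ midIndices N r, (|l i| - t) ^ 2 :=
    Finset.sum_nonneg fun i _ ↦ sq_nonneg _
  have hL0 : 0 ≤ ∑ i ∈ lastIndices N r, (|l i| - μ) ^ 2 :=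
    Finset.sum_nonneg fun i _ ↦ sq_nonneg _
  have hsqs := Fin.sum_eq_add_sum_mid_add_sum_last hrN (fun i ↦ l i ^ 2)
  have habs := Fin.sum_eq_add_sum_mid_add_sum_last hrN (fun i ↦ |l i|)
  rw [abs_of_nonneg hl0] at habs
  set SL := ∑ i ∈ lastIndices N r, |l i|
  have hslack : 0 ≤ 2 * (μ - t) * (SL - l 0) :=
    mul_nonneg (by linarith) (by linarith)
  -- `hμr` matches the coefficients of `l 0`, `hid` the constants.
  have key : 2 * t * (2 * ((r - 1) * μ) + (N - r) * t - ∑ i, |l i|) =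
      (N * l 0 - ∑ i, l i ^ 2) + (l 0 - (r - 1) * μ) ^ 2 + 2 * (μ - t) * (SL - l 0) +
      ∑ i ∈ midIndices N r, (|l i| - t) ^ 2 +
      ∑ i ∈ lastIndices N r, (|l i| - μ) ^ 2 := by
    rw [hM, hL, hsqs, habs]
    linear_combination (2 * l 0 - 2 * ((r - 1) * μ)) * hμr - hid
  refine ⟨?_, fun h ↦ ?_, fun h ↦ ?_⟩
  · have : 0 ≤ 2 * t * (2 * ((r - 1) * μ) + (N - r) * t - ∑ i, |l i|) := by
      rw [key]; nlinarith [sq_nonneg (l 0 - (r - 1) * μ)]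
    have := nonneg_of_mul_nonneg_right this (by linarith)
    linarith
  · rw [h, sub_self, mul_zero] at key
    have h0 : l 0 = (r - 1) * μ := by
      have := sq_nonneg (l 0 - (r - 1) * μ)
      have : (l 0 - (r - 1) * μ) ^ 2 = 0 := by linarith
      exact sub_eq_zero.1 (pow_eq_zero_iff two_ne_zero |>.1 this)
    have hsq0 := sq_nonneg (l 0 - (r - 1) * μ)
    have hM1 : ∑ i ∈ midIndices N r, (|l i| - t) ^ 2 = 0 := by linarith
    have hL1 : ∑ i ∈ lastIndices N r, (|l i| - μ) ^ 2 = 0 := by linarith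
    rw [Finset.sum_eq_zero_iff_of_nonneg fun i _ ↦ sq_nonneg _] at hM1 hL1
    have hLμ : ∀ i : Fin N, N + 1 ≤ (i : ℕ) + r → |l i| = μ := fun i hi ↦
      sub_eq_zero.1 (pow_eq_zero_iff two_ne_zero |>.1 (hL1 i (by simpa using hi)))
    refine ⟨by linarith, h0, fun i hi ↦ ?_, fun i hi hi' ↦
      sub_eq_zero.1 (pow_eq_zero_iff two_ne_zero |>.1 (hM1 i (by simpa using ⟨hi, hi'⟩)))⟩
    -- Absolute values leave the signs open. Equality in `hlast` makes every negative part equal to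
    -- `μ > 0`, so these entries are negative.
    have hle : ∀ i ∈ lastIndices N r,
        max (-l i) 0 ≤ μ := fun i hi ↦
      hLμ i (by simpa using hi) ▸ max_le (neg_le_abs _) (abs_nonneg _)
    have heq := (Finset.sum_eq_sum_iff_of_le hle).1 (le_antisymm (Finset.sum_le_sum hle) (by
      rw [Finset.sum_const, nsmul_eq_mul, hcl, ← h0]; exact hlast)) i (by simpa using hi)
    rcases max_choice (-l i) 0 with h' | h' <;> rw [h'] at heq <;> linarith
  · obtain ⟨h1, h2, h3, h4⟩ := h
    have hM1 : ∑ i ∈ midIndices N r, (|l i| - t) ^ 2 = 0 :=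
      Finset.sum_eq_zero fun i hi ↦ by
        simp only [mem_midIndices] at hi
        simp [h4 i hi.1 hi.2]
    have hμ0 : |μ| = μ := abs_of_pos (by linarith)
    have hL1 : ∑ i ∈ lastIndices N r, (|l i| - μ) ^ 2 = 0 :=
      Finset.sum_eq_zero fun i hi ↦ by
        simp only [mem_lastIndices] at hi
        simp [h3 i hi, hμ0]
    have hSL : SL = (r - 1) * μ := by
      rw [← hcl, ← nsmul_eq_mul, ← Finset.sum_const]
      refine Finset.sum_congr rfl fun i hi ↦ ?_
      simp only [mem_lastIndices] at hi
      simp [h3 i hi, hμ0]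
    rw [hM1, hL1, hSL, h1, h2] at key
    simp only [sub_self, mul_zero, ne_eq, OfNat.ofNat_ne_zero, not_false_eq_true, zero_pow,
      add_zero, mul_eq_zero, ht.ne', or_false, false_or] at key
    linarith

end Fin

/-! ### The bound and its equality case for graphs. -/

theorem SimpleGraph.le_sum_lastIndices {V : Type*} [Fintype V] [DecidableEq V]
    (G : SimpleGraph V) [DecidableRel G.Adj] {r : ℕ} [NeZero (Fintype.card V)] (hr : 2 ≤ r)
    (hrV : r ≤ Fintype.card V) (hG : G.Colorable r) (h0 : 0 ≤ G.eigenvalue 0) :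
    G.eigenvalue 0 ≤ ∑ i ∈ lastIndices (Fintype.card V) r, max (-G.eigenvalue i) 0 := by
  obtain ⟨q, hq0, hq1, hq, hqr, hlq⟩ := G.exists_weights hG 0
  exact le_sum_last_of_weights hr hrV G.eigenvalue_antitone h0 hq0 hq1 hq hqr hlq

theorem mainTheorem7 {V : Type*} [Fintype V] [DecidableEq V] (G : SimpleGraph V)
    [DecidableRel G.Adj] (n r : ℕ) (hV : Fintype.card V = n) (hr : 2 ≤ r)
    (hn : 4 * ((r : ℝ) - 1) ^ 2 ≤ n) (hG : G.Partitionable r) :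
    G.traceNorm ≤ n * (n - r) / (2 * √((n - r) * (r / (r - 1)) + 4)) + (r - 1) * n / r
        + 2 * (r - 1) * n / (r * √((n - r) * (r / (r - 1)) + 4)) ∧
    (G.traceNorm = n * (n - r) / (2 * √((n - r) * (r / (r - 1)) + 4)) + (r - 1) * n / r
        + 2 * (r - 1) * n / (r * √((n - r) * (r / (r - 1)) + 4)) ↔
      (∃ d : ℕ, G.IsRegularOfDegree d ∧
        (d : ℝ) = (1 + 2 / √((n - r) * (r / (r - 1)) + 4)) * ((r - 1) * n / (2 * r))) ∧
      (∀ i : Fin (Fintype.card V), n + 2 ≤ ((i : ℕ) + 1) + r →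
        G.eigenvalue i = -((1 + 2 / √((n - r) * (r / (r - 1)) + 4)) * (n / (2 * r)))) ∧
      (∀ i : Fin (Fintype.card V), 2 ≤ (i : ℕ) + 1 → ((i : ℕ) + 1) + r ≤ n + 1 →
        |G.eigenvalue i| = n / (2 * √((n - r) * (r / (r - 1)) + 4)))) := by
  subst hV
  set N := Fintype.card V with hN
  have hr2 : (2 : ℝ) ≤ r := by exact_mod_cast hr
  have hr1 : (0 : ℝ) < r - 1 := by linarith
  have hr0 : (0 : ℝ) < r := by linarith
  have hrN' : (r : ℝ) ≤ N := by nlinarith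
  have hrN : r ≤ N := by exact_mod_cast hrN'
  have hN0 : (0 : ℝ) < N := by linarith
  have : NeZero N := ⟨by omega⟩
  have hnn : 0 ≤ ((N : ℝ) - r) * (r / (r - 1)) :=
    mul_nonneg (by linarith) (div_nonneg hr0.le hr1.le)
  have hs2 : √(((N : ℝ) - r) * (r / (r - 1)) + 4) ^ 2 = (N - r) * (r / (r - 1)) + 4 :=
    Real.sq_sqrt (by linarith)
  have hs0 : 0 < √(((N : ℝ) - r) * (r / (r - 1)) + 4) := Real.sqrt_pos.2 (by linarith)
  set s := √(((N : ℝ) - r) * (r / (r - 1)) + 4)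
  have hNr : (N : ℝ) - r = (r - 1) * (s ^ 2 - 4) / r := by
    rw [hs2]; field_simp; ring
  -- Equivalent to `t ≤ μ`; the lower bound on `n` enters here.
  have hrs : (r : ℝ) ≤ s + 2 := by
    have h1 : (N : ℝ) - r ≤ (N - r) * (r / (r - 1)) :=
      le_mul_of_one_le_right (by linarith) ((one_le_div hr1).2 (by linarith))
    have h2 : ((r : ℝ) - 2) ^ 2 ≤ s ^ 2 := by nlinarith
    linarith [(abs_le.1 (abs_le_of_sq_le_sq h2 hs0.le)).2]
  set t := (N : ℝ) / (2 * s) with ht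
  set μ := (1 + 2 / s) * ((N : ℝ) / (2 * r)) with hμ
  have ht0 : 0 < t := by positivity
  have htμ : t ≤ μ := by
    have h : μ - t = N * (s + 2 - r) / (2 * r * s) := by
      rw [hμ, ht]; field_simp
    have : 0 ≤ μ - t := by
      rw [h]
      exact div_nonneg (mul_nonneg hN0.le (by linarith)) (by positivity)
    linarith
  have hμr : r * μ = N / 2 + 2 * t := by
    rw [hμ, ht]; field_simp
  have hid : N * ((r - 1) * μ) = ((r - 1) * μ) ^ 2 + (r - 1) * μ ^ 2 + (N - r) * t ^ 2 := by
    rw [hNr, hμ, ht]; field_simp; ring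
  have hbound : N * (N - r) / (2 * s) + (r - 1) * N / r + 2 * (r - 1) * N / (r * s) =
      2 * ((r - 1) * μ) + (N - r) * t := by
    rw [hμ, ht]; field_simp; ring
  have hdeg : (1 + 2 / s) * (((r : ℝ) - 1) * N / (2 * r)) = (r - 1) * μ := by
    rw [hμ]; ring
  rw [hbound, hdeg, G.traceNorm_eq_sum_abs_eigenvalue]
  have hmax : ∀ i, G.eigenvalue i ≤ G.eigenvalue 0 := fun i ↦ G.eigenvalue_antitone (Fin.zero_le i)
  have hdle := G.sum_degree_le hmax
  have hd0 : 0 ≤ ∑ v, (G.degree v : ℝ) := Finset.sum_nonneg fun _ _ ↦ Nat.cast_nonneg _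
  have hl0 : 0 ≤ G.eigenvalue 0 := nonneg_of_mul_nonneg_left (hd0.trans hdle) hN0
  obtain ⟨hle, heq⟩ := sum_abs_le_and_eq_iff hr hrN ht0 htμ hμr hid hl0
    (by rw [G.sum_eigenvalue_sq, mul_comm]; exact hdle)
    (G.le_sum_lastIndices hr hrN (SimpleGraph.partitionable_iff_colorable.1 hG) hl0)
  refine ⟨hle, heq.trans ⟨?_, ?_⟩⟩
  · rintro ⟨h1, h2, h3, h4⟩
    have hdv := G.degree_eq_of_sum_degree_eq hmax (by rw [← G.sum_eigenvalue_sq, h1, mul_comm])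
    obtain ⟨v⟩ : Nonempty V := Fintype.card_pos_iff.1 (by omega)
    exact ⟨⟨G.degree v, fun w ↦ by exact_mod_cast (hdv w).trans (hdv v).symm,
      (hdv v).trans h2⟩, fun i hi ↦ h3 i (by omega), fun i hi hi' ↦ h4 i (by omega) (by omega)⟩
  · rintro ⟨⟨d, hreg, hd⟩, h3, h4⟩
    have h3' : ∀ i : Fin N, N + 1 ≤ (i : ℕ) + r → G.eigenvalue i = -μ := fun i hi ↦
      h3 i (by omega)
    have h4' : ∀ i : Fin N, 1 ≤ (i : ℕ) → (i : ℕ) + r ≤ N → |G.eigenvalue i| = t :=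
      fun i hi hi' ↦ h4 i (by omega) (by omega)
    have hsum : ∑ v, (G.degree v : ℝ) = N * ((r - 1) * μ) := by
      rw [← hd, Finset.sum_congr rfl fun v _ ↦ by rw [hreg v]]
      simp [hN]
    have hsq := Fin.sum_eq_add_sum_mid_add_sum_last hrN fun i ↦ G.eigenvalue i ^ 2
    have hmid : ∑ i ∈ midIndices N r, G.eigenvalue i ^ 2 = (N - r) * t ^ 2 := by
      rw [Finset.sum_congr rfl fun i hi ↦ by
        rw [← sq_abs, h4' i (mem_midIndices.1 hi).1 (mem_midIndices.1 hi).2]]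
      rw [Finset.sum_const, card_midIndices hr hrN, nsmul_eq_mul, Nat.cast_sub hrN]
    have hlast : ∑ i ∈ lastIndices N r, G.eigenvalue i ^ 2 = (r - 1) * μ ^ 2 := by
      rw [Finset.sum_congr rfl fun i hi ↦ by rw [h3' i (mem_lastIndices.1 hi), neg_sq]]
      rw [Finset.sum_const, card_lastIndices hr hrN, nsmul_eq_mul, Nat.cast_sub (by omega),
        Nat.cast_one]
    -- The three conditions do not mention `λ_1`; the sum of squares and `hid` determine `λ_1²`.
    have hl : G.eigenvalue 0 = (r - 1) * μ := by
      refine (sq_eq_sq₀ hl0 (hd ▸ Nat.cast_nonneg d)).1 ?_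
      rw [G.sum_eigenvalue_sq, hsum, hmid, hlast] at hsq
      linarith
    exact ⟨by rw [G.sum_eigenvalue_sq, hsum, hl], hl, h3', h4'⟩
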